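/- Let $t\ge 1$, $k\ge 2t$ and $v\ge k$ be integers, let $X$ be a $v$-set, $n=\binom vt$, and index matrices by the $t$-subsets of $X$. Put $\xi_i=\binom{v-t-i}{k-t-i}$ for $0\le i\le t$ and $M(T,U)=\xi_{|T\setminus U|}$ (the number of $k$-subsets of $X$ containing $T\cup U$). Fix a $t$-subset $T_0$ of $X$, let $B$ be the $n\times n$ identity matrix with its column $T_0$ replaced by the all-ones vector, and let $M_1=MB$. Let $A_0,\dots,A_t$ be the adjacency matrices of the Johnson scheme ($A_i(S,T)=1$ if $|S\cap T|=t-i$, and $0$ otherwise), let $$P_{ij}=\sum_{s=0}^i(-1)^{i-s}\binom{t-s}{i-s}\binom{t-j}{s}\binom{v-t+s-j}{s},\qquad \theta_j=\sum_{i=0}^t\xi_iP_{ij},\qquad m_j=\binom vj-\binom v{j-1}\qquad(0\le i,j\le t),$$ and let $E_j$ be the orthogonal projection onto $\{x\in\mathbb R^n : A_ix=P_{ij}x \text{ for } 0\le i\le t\}$. Let $e^{(j)}$ be the unit vector in the direction of the column $T_0$ of $E_j$, let $V=[e^{(0)}\ \cdots\ e^{(t)}]$, $\Theta=\operatorname{diag}(\theta_0,\dots,\theta_t)$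 and $R=V^\top MBV$. (1) For all $v\ge k$ and all $T_0$, the characteristic polynomial of $M_1$ is $$\chi_{M_1}(x)=\chi_R(x)\prod_{j=1}^t(x-\theta_j)^{m_j-1},$$ and $R$ is a rank-one perturbation of $\Theta$: $\operatorname{rank}(R-\Theta)=1$ and $R=\Theta\,(I+\mathbf u\,\mathbf w^\top)$, where $\mathbf u_i=\delta_{i0}-\sqrt{m_i}/n$ and $\mathbf w_j=\sqrt{m_j}$ for $0\le i,j\le t$. (2) There are $v_0$ and $c,c'>0$, depending only on $t$ and $k$, such that for all $v\ge\max(v_0,k)$ and all $T_0$: the matrix $R$ has $t+1$ distinct real eigenvalues, each greater than $\theta_t/2$; and every complex eigenvalue $\lambda$ of $M_1$ is real, with $\lambda>\theta_t/2$ and $c\,v^{k-t}\le\lambda\le c'\,v^{k-t}$. -/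

import Mathlib

open Polynomial

namespace JohnsonCoverage

/-- The `t`-subsets of the `v`-set `{0, …, v-1}`. -/
abbrev TSet (v t : ℕ) : Type := {T : Finset (Fin v) // T.card = t}

/-- `ξ_i`, the number of `k`-subsets of a `v`-set that contain a given set of size `t + i`.
It is used for `i ≤ t`, `2 * t ≤ k ≤ v`, where no subtraction truncates. -/
def xi (v t k i : ℕ) : ℕ := (v - t - i).choose (k - t - i)

/-- The coverage matrix: its `(T, U)` entry is the number of `k`-subsets containing `T ∪ U`. -/
def covM (v t k : ℕ) : Matrix (TSet v t) (TSet v t) ℝ :=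
  Matrix.of fun T U => (xi v t k (T.1 \ U.1).card : ℝ)

/-- The matrix `B`: the identity, with the column of the `t`-set `T₀` (the "first" one)
replaced by the all-ones vector. -/
def matB {v t : ℕ} (T₀ : TSet v t) : Matrix (TSet v t) (TSet v t) ℝ :=
  Matrix.of fun S T => if T = T₀ then 1 else if S = T then 1 else 0

/-- `M₁ = M B`. -/
noncomputable def covM₁ {v t : ℕ} (k : ℕ) (T₀ : TSet v t) : Matrix (TSet v t) (TSet v t) ℝ :=
  covM v t k * matB T₀

/-- The adjacency matrices of the Johnson scheme: `S` and `T` are `i`-th associates iff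
`|S ∩ T| = t - i`, that is, `|S ∩ T| + i = t`. -/
def johnsonA (v t i : ℕ) : Matrix (TSet v t) (TSet v t) ℝ :=
  Matrix.of fun S T => if (S.1 ∩ T.1).card + i = t then 1 else 0

/-- The entries `P_{ij}` of the first eigenmatrix of the Johnson scheme. It is used for
`i, j ≤ t` and `2 * t ≤ v`, where no subtraction truncates. -/
def johnsonP (v t i j : ℕ) : ℝ :=
  ∑ s ∈ Finset.range (i + 1),
    (-1 : ℝ) ^ (i - s) * ((t - s).choose (i - s) : ℝ) * ((t - j).choose s : ℝ)
      * ((v - t + s - j).choose s : ℝ)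

/-- `θ_j = ∑_{i=0}^t ξ_i P_{ij}`. -/
def theta (v t k j : ℕ) : ℝ :=
  ∑ i ∈ Finset.range (t + 1), (xi v t k i : ℝ) * johnsonP v t i j

/-- `m_j = C(v, j) - C(v, j - 1)`, with `C(v, -1) = 0`. -/
def mult (v : ℕ) : ℕ → ℕ
  | 0 => 1
  | j + 1 => v.choose (j + 1) - v.choose j

/-- The `j`-th common eigenspace of the Johnson scheme: `A_i` acts on it as `P_{ij}`,
for every `i = 0, …, t`. -/
noncomputable def johnsonSpace (v t j : ℕ) : Submodule ℝ (EuclideanSpace ℝ (TSet v t)) :=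
  ⨅ i : Fin (t + 1),
    Module.End.eigenspace (Matrix.toEuclideanLin (johnsonA v t i)) (johnsonP v t i j)

/-- The primitive idempotent `E_j`: the matrix of the orthogonal projection onto the
`j`-th common eigenspace. -/
noncomputable def johnsonE (v t j : ℕ) : Matrix (TSet v t) (TSet v t) ℝ :=
  Matrix.of fun S T => (johnsonSpace v t j).starProjection (EuclideanSpace.single T 1) S

/-- The unit vector `e^{(j)}`, the normalized `T₀`-column of `E_j`. -/
noncomputable def unitE {v t : ℕ} (T₀ : TSet v t) (j : ℕ) : EuclideanSpace ℝ (TSet v t) :=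
  ‖WithLp.toLp 2 ((johnsonE v t j).col T₀)‖⁻¹ • WithLp.toLp 2 ((johnsonE v t j).col T₀)

/-- The matrix with columns `e^{(0)}, …, e^{(t)}`. -/
noncomputable def matV {v t : ℕ} (T₀ : TSet v t) : Matrix (TSet v t) (Fin (t + 1)) ℝ :=
  Matrix.of fun S j => unitE T₀ j S

/-- `R = Vᵀ M B V`. -/
noncomputable def matR {v t : ℕ} (k : ℕ) (T₀ : TSet v t) :
    Matrix (Fin (t + 1)) (Fin (t + 1)) ℝ :=
  (matV T₀).transpose * covM v t k * matB T₀ * matV T₀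

/-- `Θ = diag(θ_0, …, θ_t)`. -/
def matTheta (v t k : ℕ) : Matrix (Fin (t + 1)) (Fin (t + 1)) ℝ :=
  Matrix.diagonal fun j => theta v t k j

end JohnsonCoverage

/-!
The matrix `M = ∑ ξ_i A_i` acts as `θ_j` on the `j`-th eigenspace of the Johnson scheme, and
`M₁ = M B` is the rank-one perturbation `M + M(𝟙 - e_{T₀}) e_{T₀}ᵀ`. Split `𝟙 - e_{T₀}` along the
eigenspaces. By transitivity of the symmetric group on `t`-sets, the component of `e_{T₀}` in the
`j`-th one has `T₀`-entry `m_j / n`, so the matrix determinant lemma shows that `χ_{M₁}` is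
`χ_M / ∏ (x - θ_j)` times the secular polynomial
`∏ (x - θ_j) · (1 - ∑ θ_j (δ_{j0} - m_j / n) / (x - θ_j))`. The same computation in the
basis `e^{(j)}` gives `R = Θ (I + u wᵀ)`, whose characteristic polynomial is the secular polynomial.

The eigenspace dimensions come from lifting harmonic functions on `j`-sets to `t`-sets: this gives
at least `m_j` independent eigenvectors, and `∑ m_j = n`. The same eigenvectors, applied to
`M = W Wᵀ` with `W` the inclusion matrix of `t`-sets in `k`-sets, show
`θ_j = C(k-j, t-j) C(v-t-j, k-t)`; hence `θ_0 > ⋯ > θ_t > 0`, all of order `v^{k-t}`. At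
`2 θ_0, θ_1, …, θ_t, θ_t / 2` the secular polynomial alternates in sign, which separates `t + 1`
real roots, all above `θ_t / 2`.
-/

namespace JohnsonCoverage

section RankOnePerturbation

open Matrix

variable {R n ι : Type*} [CommRing R] [Fintype n] [DecidableEq n] [Fintype ι] [DecidableEq ι]

lemma mul_det_sub_vecMulVec {A : Matrix n n R} {a b : n → R} {d : R} (h : A *ᵥ b = d • a)
    (w : n → R) : d * (A - vecMulVec a w).det = A.det * (d - w ⬝ᵥ b) := by
  have hblocks : fromBlocks A (replicateCol Unit a) (replicateRow Unit w) 1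
        * fromBlocks 1 (replicateCol Unit (-b)) 0 (d • (1 : Matrix Unit Unit R))
      = fromBlocks A 0 (replicateRow Unit w)
          (replicateRow Unit w * replicateCol Unit (-b) + d • 1) := by
    rw [fromBlocks_multiply]
    congr 1
    · simp
    · rw [← replicateCol_mulVec, mulVec_neg, h]
      ext
      simp
    · simp
    · simp
  have hdet := congrArg det hblocks
  rw [det_mul, det_fromBlocks_one₂₂, ← vecMulVec_eq, det_fromBlocks_zero₂₁,
    det_fromBlocks_zero₁₂] at hdet
  simpa [Matrix.mul_apply, dotProduct, neg_add_eq_sub, mul_comm d] using hdet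

/-- The polynomial `∏ j, (X - θ j) * (1 - ∑ j, a j / (X - θ j))` with its denominators cleared: the
secular equation of a rank-one perturbation of `diag θ`. -/
noncomputable def secularPoly (θ a : ι → R) : R[X] :=
  ∏ j, (X - C (θ j)) - ∑ j, C (a j) * ∏ i ∈ Finset.univ.erase j, (X - C (θ i))

lemma prod_mul_charpoly_add_vecMulVec {M : Matrix n n R} {θ : ι → R} {a : ι → n → R}
    (hM : ∀ j, M *ᵥ a j = θ j • a j) (w : n → R) :
    (∏ j, (X - C (θ j))) * (M + vecMulVec (∑ j, a j) w).charpoly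
      = M.charpoly * secularPoly θ fun j => w ⬝ᵥ a j := by
  have ha : ∀ j, charmatrix M *ᵥ (C ∘ a j) = (X - C (θ j)) • (C ∘ a j) := by
    intro j
    rw [charmatrix, sub_mulVec, sub_smul, scalar_apply, ← smul_one_eq_diagonal, smul_mulVec,
      one_mulVec]
    congr 1
    ext i : 1
    rw [RingHom.mapMatrix_apply, ← RingHom.map_mulVec, hM]
    simp
  have hsolve : charmatrix M *ᵥ ∑ j, (∏ i ∈ Finset.univ.erase j, (X - C (θ i))) • (C ∘ a j)
      = (∏ j, (X - C (θ j))) • ∑ j, C ∘ a j := by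
    rw [mulVec_sum, Finset.smul_sum]
    refine Finset.sum_congr rfl fun j _ => ?_
    rw [mulVec_smul, ha, smul_smul, Finset.prod_erase_mul _ _ (Finset.mem_univ j)]
  have hchar : charmatrix (M + vecMulVec (∑ j, a j) w)
      = charmatrix M - vecMulVec (∑ j, C ∘ a j) (C ∘ w) := by
    ext i l : 2
    simp [charmatrix, vecMulVec_apply, sub_sub]
  rw [charpoly, charpoly, hchar, mul_det_sub_vecMulVec hsolve, secularPoly]
  congr 2
  rw [dotProduct_sum]
  refine Finset.sum_congr rfl fun j _ => ?_
  rw [dotProduct_smul, smul_eq_mul, mul_comm, dotProduct, dotProduct, map_sum]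
  simp

lemma charpoly_diagonal_add_vecMulVec (θ u w : ι → R) :
    (diagonal θ + vecMulVec u w).charpoly = secularPoly θ (w * u) := by
  have h := prod_mul_charpoly_add_vecMulVec (M := diagonal θ) (θ := θ)
    (a := fun j => Pi.single j (u j)) (fun j => by
      ext i
      by_cases hij : i = j
      · subst hij; simp [mulVec_diagonal]
      · simp [hij, mulVec_diagonal]) w
  rw [charpoly_diagonal, Finset.univ_sum_single] at h
  simpa [Pi.mul_def] using (monic_prod_of_monic _ _ fun j _ => monic_X_sub_C (θ j)).isRegular.left h

lemma charpoly_add_vecMulVec_eq_secularPoly_mul {M : Matrix n n R} {θ : ι → R} {a : ι → n → R}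
    (hM : ∀ j, M *ᵥ a j = θ j • a j) {m : ι → ℕ} (hm : ∀ j, 0 < m j)
    (hchar : M.charpoly = ∏ j, (X - C (θ j)) ^ m j) (w : n → R) :
    (M + vecMulVec (∑ j, a j) w).charpoly
      = (secularPoly θ fun j => w ⬝ᵥ a j) * ∏ j, (X - C (θ j)) ^ (m j - 1) := by
  have hmonic : (∏ j, (X - C (θ j))).Monic := monic_prod_of_monic _ _ fun j _ => monic_X_sub_C _
  have hsplit : M.charpoly = (∏ j, (X - C (θ j))) * ∏ j, (X - C (θ j)) ^ (m j - 1) := by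
    rw [hchar, ← Finset.prod_mul_distrib]
    exact Finset.prod_congr rfl fun j _ => (mul_pow_sub_one (hm j).ne' _).symm
  refine hmonic.isRegular.left ?_
  change _ * _ = _ * _
  rw [prod_mul_charpoly_add_vecMulVec hM, hsplit]
  ring

lemma eval_secularPoly_self (θ a : ι → R) (j : ι) :
    (secularPoly θ a).eval (θ j) = -(a j * ∏ i ∈ Finset.univ.erase j, (θ j - θ i)) := by
  have hother : ∀ l ≠ j, ∏ i ∈ Finset.univ.erase l, (θ j - θ i) = 0 := fun l hl =>
    Finset.prod_eq_zero (Finset.mem_erase.2 ⟨hl.symm, Finset.mem_univ j⟩) (sub_self _)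
  simp only [secularPoly, eval_sub, eval_finsetSum, eval_mul, eval_C, eval_prod, eval_X]
  rw [Finset.prod_eq_zero (Finset.mem_univ j) (sub_self _), Fintype.sum_eq_single j, zero_sub]
  exact fun l hl => by rw [hother l hl, mul_zero]

lemma eval_secularPoly {K : Type*} [Field K] {θ : ι → K} (a : ι → K) {x : K}
    (hx : ∀ j, x ≠ θ j) :
    (secularPoly θ a).eval x = (∏ j, (x - θ j)) * (1 - ∑ j, a j / (x - θ j)) := by
  simp only [secularPoly, eval_sub, eval_finsetSum, eval_mul, eval_C, eval_prod, eval_X]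
  rw [mul_sub, mul_one, Finset.mul_sum]
  congr 1
  refine Finset.sum_congr rfl fun j _ => ?_
  have := sub_ne_zero.2 (hx j)
  rw [← Finset.mul_prod_erase _ _ (Finset.mem_univ j)]
  field_simp

lemma rank_vecMulVec_eq_one {K m n : Type*} [Field K] [Fintype n] {a : m → K}
    {b : n → K} (ha : a ≠ 0) (hb : b ≠ 0) : (vecMulVec a b).rank = 1 := by
  classical
  refine (rank_vecMulVec_le a b).antisymm (Nat.one_le_iff_ne_zero.2 fun h => ?_)
  rw [Matrix.rank, Submodule.finrank_eq_zero, LinearMap.range_eq_bot] at h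
  obtain ⟨i, hi⟩ := Function.ne_iff.1 ha
  obtain ⟨j, hj⟩ := Function.ne_iff.1 hb
  have hentry := congrFun (LinearMap.congr_fun h (Pi.single j 1)) i
  simp only [mulVecLin_apply, mulVec_single_one, col_apply, vecMulVec_apply] at hentry
  exact mul_ne_zero hi hj hentry

end RankOnePerturbation

section SecularEquation

lemma exists_roots_of_alternating {p : ℝ[X]} {d : ℕ} (hp : p.Monic) (hd : p.natDegree = d)
    {b : Fin (d + 1) → ℝ} (hb : StrictAnti b)
    (hs : ∀ j : Fin (d + 1), 0 < (-1) ^ (j : ℕ) * p.eval (b j)) :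
    ∃ ρ : Fin d → ℝ, StrictMono ρ ∧ p = ∏ i, (X - C (ρ i)) ∧
      ∀ i, ρ i ∈ Set.Ioo (b (Fin.last d)) (b 0) := by
  have hroot : ∀ j : Fin d, ∃ r ∈ Set.Ioo (b j.succ) (b j.castSucc), p.IsRoot r := by
    intro j
    have hcont : ContinuousOn (fun x => (-1) ^ (j : ℕ) * p.eval x)
        (Set.Icc (b j.succ) (b j.castSucc)) := by fun_prop
    have hsucc := hs j.succ
    rw [Fin.val_succ, pow_succ, mul_neg_one, neg_mul, neg_pos] at hsucc
    obtain ⟨r, hr, hr0⟩ := intermediate_value_Ioo (hb j.castSucc_lt_succ).le hcont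
      ⟨hsucc, hs j.castSucc⟩
    exact ⟨r, hr, (mul_eq_zero.1 hr0).resolve_left (by simp)⟩
  choose r hr hroot using hroot
  have hanti : StrictAnti r := fun i j hij =>
    (hr j).2.trans_le ((hb.antitone (Fin.succ_le_castSucc_iff.2 hij)).trans (hr i).1.le)
  have hmono : StrictMono (r ∘ Fin.rev) := hanti.comp Fin.rev_strictAnti
  refine ⟨r ∘ Fin.rev, hmono, ?_, fun i => ⟨?_, ?_⟩⟩
  · refine eq_of_monic_of_dvd_of_natDegree_le
      (monic_prod_of_monic _ _ fun i _ => monic_X_sub_C _) hp ?_ ?_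
    · exact Finset.prod_dvd_of_coprime
        ((pairwise_coprime_X_sub_C hmono.injective).set_pairwise _)
        fun i _ => dvd_iff_isRoot.2 (hroot _)
    · rw [natDegree_prod_of_monic _ _ fun i _ => monic_X_sub_C _]
      simp [hd]
  · exact (hb.antitone (Fin.le_last _)).trans_lt (hr _).1
  · exact (hr _).2.trans_le (hb.antitone (Fin.zero_le _))

lemma neg_one_pow_card_mul_prod_sub_pos {ι : Type*} {s : Finset ι} {θ : ι → ℝ} {x : ℝ}
    (h : ∀ i ∈ s, x < θ i) : 0 < (-1) ^ s.card * ∏ i ∈ s, (x - θ i) := by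
  rw [← Finset.prod_neg]
  exact Finset.prod_pos fun i hi => by linarith [h i hi]

lemma neg_one_pow_mul_prod_erase_sub_pos {d : ℕ} {θ : Fin d → ℝ} (hθ : StrictAnti θ)
    (j : Fin d) : 0 < (-1) ^ (j : ℕ) * ∏ i ∈ Finset.univ.erase j, (θ j - θ i) := by
  have hsplit : Finset.univ.erase j = (Finset.Iio j).disjUnion (Finset.Ioi j)
      (Finset.disjoint_left.2 fun i hi hi' => by simp_all [lt_asymm]) := by
    ext i
    simp [lt_or_lt_iff_ne]
  rw [hsplit, Finset.prod_disjUnion, ← mul_assoc]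
  refine mul_pos ?_ (Finset.prod_pos fun i hi => sub_pos.2 (hθ (Finset.mem_Ioi.1 hi)))
  simpa using neg_one_pow_card_mul_prod_sub_pos (s := Finset.Iio j) (x := θ j)
    fun i hi => hθ (Finset.mem_Iio.1 hi)

lemma exists_roots_secularPoly {t : ℕ} {θ a : Fin (t + 1) → ℝ} {A B : ℝ} (hθ : StrictAnti θ)
    (ha : ∀ j ≠ 0, a j < 0) (hA : A < θ (Fin.last t)) (hB : θ 0 < B)
    (hsA : ∑ j, a j / (A - θ j) < 1) (hsB : ∑ j, a j / (B - θ j) < 1) :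
    ∃ ρ : Fin (t + 1) → ℝ, StrictMono ρ ∧ secularPoly θ a = ∏ i, (X - C (ρ i)) ∧
      ∀ i, ρ i ∈ Set.Ioo A B := by
  have hAθ : ∀ j, A < θ j := fun j => hA.trans_le (hθ.antitone (Fin.le_last j))
  have hθB : ∀ j, θ j < B := fun j => (hθ.antitone (Fin.zero_le j)).trans_lt hB
  let b : Fin (t + 2) → ℝ := Fin.snoc (Function.update θ 0 B) A
  have hb : StrictAnti b := by
    refine Fin.strictAnti_iff_succ_lt.2 fun j => ?_
    have hle : θ j ≤ b j.castSucc := by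
      rcases eq_or_ne j 0 with rfl | hj
      · simpa [b] using (hθB 0).le
      · simp [b, hj]
    refine lt_of_lt_of_le ?_ hle
    induction j using Fin.lastCases with
    | last => simpa only [b, Fin.succ_last, Fin.snoc_last] using hA
    | cast j =>
      simpa only [b, Fin.succ_castSucc, Fin.snoc_castSucc,
        Function.update_of_ne (Fin.succ_ne_zero j)] using hθ j.castSucc_lt_succ
  have hs : ∀ j : Fin (t + 2), 0 < (-1) ^ (j : ℕ) * (secularPoly θ a).eval (b j) := by
    intro j
    induction j using Fin.lastCases with
    | last =>
      have := neg_one_pow_card_mul_prod_sub_pos (s := Finset.univ) fun j _ => hAθ j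
      rw [Finset.card_fin] at this
      simpa [b, eval_secularPoly _ fun j => (hAθ j).ne, ← mul_assoc, sub_pos] using
        mul_pos this (sub_pos.2 hsA)
    | cast j =>
      rcases eq_or_ne j 0 with rfl | hj
      · simpa [b, eval_secularPoly _ fun j => (hθB j).ne'] using
          mul_pos (Finset.prod_pos fun j _ => sub_pos.2 (hθB j)) (sub_pos.2 hsB)
      · have := mul_pos (neg_pos.2 (ha j hj)) (neg_one_pow_mul_prod_erase_sub_pos hθ j)
        simp only [b, Fin.snoc_castSucc, Function.update_of_ne hj, eval_secularPoly_self,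
          Fin.val_castSucc]
        linarith
  have hmonic : (secularPoly θ a).Monic ∧ (secularPoly θ a).natDegree = t + 1 := by
    rw [← one_mul a, ← charpoly_diagonal_add_vecMulVec θ a 1]
    exact ⟨Matrix.charpoly_monic _, by simp [Matrix.charpoly_natDegree_eq_dim]⟩
  simpa [b] using exists_roots_of_alternating hmonic.1 hmonic.2 hb hs

lemma sum_div_sub_lt_one_iff {ι : Type*} [Fintype ι] [DecidableEq ι] {θ μ : ι → ℝ}
    (hμ : ∑ j, μ j = 1) (i₀ : ι) {x : ℝ} (hx : ∀ j, x ≠ θ j) :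
    ∑ j, θ j * ((if j = i₀ then 1 else 0) - μ j) / (x - θ j) < 1 ↔
      θ i₀ / (x - θ i₀) < ∑ j, μ j * (x / (x - θ j)) := by
  have hterm : ∀ j, θ j * ((if j = i₀ then 1 else 0) - μ j) / (x - θ j)
      = (if j = i₀ then θ j / (x - θ j) else 0) + μ j - μ j * (x / (x - θ j)) := by
    intro j
    have := sub_ne_zero.2 (hx j)
    split_ifs <;> field_simp <;> ring
  rw [Fintype.sum_congr _ _ hterm, Finset.sum_sub_distrib, Finset.sum_add_distrib, hμ,
    Fintype.sum_ite_eq' i₀]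
  constructor <;> intro h <;> linarith

lemma exists_roots_secularPoly_of_weights {t : ℕ} {θ μ : Fin (t + 1) → ℝ} (hθ : StrictAnti θ)
    (hθ_pos : ∀ j, 0 < θ j) (hμ_pos : ∀ j, 0 < μ j) (hμ : ∑ j, μ j = 1) :
    ∃ ρ : Fin (t + 1) → ℝ, StrictMono ρ ∧
      (secularPoly θ fun j => θ j * ((if j = 0 then 1 else 0) - μ j)) = ∏ i, (X - C (ρ i)) ∧
      ∀ i, ρ i ∈ Set.Ioo (θ (Fin.last t) / 2) (2 * θ 0) := by
  have hle : ∀ j, θ (Fin.last t) ≤ θ j := fun j => hθ.antitone (Fin.le_last j)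
  have hge : ∀ j, θ j ≤ θ 0 := fun j => hθ.antitone (Fin.zero_le j)
  have hlast := hθ_pos (Fin.last t)
  have hlow : ∀ j, 0 < θ j - θ (Fin.last t) / 2 := fun j => by linarith [hle j]
  have hupp : ∀ j, 0 < 2 * θ 0 - θ j := fun j => by linarith [hge j, hθ_pos j]
  refine exists_roots_secularPoly hθ (fun j hj => ?_) (half_lt_self hlast) (by linarith [hθ_pos 0])
    ((sum_div_sub_lt_one_iff hμ 0 fun j => (sub_pos.1 (hlow j)).ne).2 ?_)
    ((sum_div_sub_lt_one_iff hμ 0 fun j => (sub_pos.1 (hupp j)).ne').2 ?_)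
  · simpa [hj] using mul_pos (hθ_pos j) (hμ_pos j)
  · calc θ 0 / (θ (Fin.last t) / 2 - θ 0) < -1 := by
          rw [← neg_sub, div_neg, neg_lt_neg_iff, one_lt_div (hlow 0)]
          linarith
      _ = ∑ j, μ j * (-1) := by rw [← Finset.sum_mul, hμ, one_mul]
      _ ≤ ∑ j, μ j * (θ (Fin.last t) / 2 / (θ (Fin.last t) / 2 - θ j)) := by
          refine Finset.sum_le_sum fun j _ => mul_le_mul_of_nonneg_left ?_ (hμ_pos j).le
          rw [← neg_sub, div_neg, neg_le_neg_iff, div_le_one (hlow j)]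
          linarith [hle j]
  · calc θ 0 / (2 * θ 0 - θ 0) = ∑ j, μ j * 1 := by
          rw [← Finset.sum_mul, hμ, two_mul, add_sub_cancel_right, div_self (hθ_pos 0).ne', one_mul]
      _ < ∑ j, μ j * (2 * θ 0 / (2 * θ 0 - θ j)) := by
          refine Finset.sum_lt_sum_of_nonempty Finset.univ_nonempty fun j _ =>
            mul_lt_mul_of_pos_left ?_ (hμ_pos j)
          rw [one_lt_div (hupp j)]
          linarith [hθ_pos j]

end SecularEquation

section EigenspaceDecomposition

variable {K V ι : Type*} [Field K] [AddCommGroup V] [Module K V] [FiniteDimensional K V]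
  [Fintype ι] [DecidableEq ι] {N : ι → Submodule K V}

lemma finrank_eq_and_isInternal_of_sum_eq_finrank (hind : iSupIndep N) {m : ι → ℕ}
    (hle : ∀ j, m j ≤ Module.finrank K (N j)) (hsum : ∑ j, m j = Module.finrank K V) :
    (∀ j, Module.finrank K (N j) = m j) ∧ DirectSum.IsInternal N := by
  have hinj : Function.Injective (DirectSum.coeLinearMap N) := hind.dfinsupp_lsum_injective
  have hfinrank := LinearMap.finrank_le_finrank_of_injective hinj
  rw [Module.finrank_directSum, ← hsum] at hfinrank
  have heq : ∑ j, m j = ∑ j, Module.finrank K (N j) :=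
    (Finset.sum_le_sum fun j _ => hle j).antisymm hfinrank
  refine ⟨fun j => ((Finset.sum_eq_sum_iff_of_le fun j _ => hle j).1 heq j
    (Finset.mem_univ j)).symm, hinj, ?_⟩
  refine (LinearMap.injective_iff_surjective_of_finrank_eq_finrank ?_).1 hinj
  rw [Module.finrank_directSum, ← heq, hsum]

lemma charpoly_eq_prod_of_isInternal (hN : DirectSum.IsInternal N) {f : V →ₗ[K] V} {θ : ι → K}
    (hf : ∀ j, ∀ x ∈ N j, f x = θ j • x) :
    f.charpoly = ∏ j, (X - C (θ j)) ^ Module.finrank K (N j) := by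
  let b := hN.collectedBasis fun j => Module.finBasis K (N j)
  have hb : LinearMap.toMatrix b b f = Matrix.diagonal fun a => θ a.1 := by
    ext a c
    rw [LinearMap.toMatrix_apply, hf c.1 _ (hN.collectedBasis_mem _ c), map_smul, b.repr_self,
      Matrix.diagonal_apply]
    rcases eq_or_ne a c with rfl | h
    · simp
    · simp [h]
  rw [← LinearMap.charpoly_toMatrix f b, hb, Matrix.charpoly_diagonal, Fintype.prod_sigma]
  simp

end EigenspaceDecomposition

section TransitiveSubspace

variable {𝕜 ι : Type*} [RCLike 𝕜] [Fintype ι] [DecidableEq ι]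
  (W : Submodule 𝕜 (EuclideanSpace 𝕜 ι))

lemma inner_starProjection_single_self (i : ι) :
    inner 𝕜 (W.starProjection (EuclideanSpace.single i 1))
      (W.starProjection (EuclideanSpace.single i 1))
      = W.starProjection (EuclideanSpace.single i 1) i := by
  rw [Submodule.inner_starProjection_left_eq_right,
    Submodule.starProjection_eq_self_iff.2 (Submodule.starProjection_apply_mem _ _)]
  simp [EuclideanSpace.inner_single_left]

lemma sum_starProjection_single_apply :
    ∑ i, W.starProjection (EuclideanSpace.single i 1) i = Module.finrank 𝕜 W := by
  have hproj : LinearMap.IsProj W (W.starProjection : _ →ₗ[𝕜] EuclideanSpace 𝕜 ι) :=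
    ⟨Submodule.starProjection_apply_mem W, fun _ => Submodule.starProjection_eq_self_iff.2⟩
  rw [← hproj.trace, LinearMap.trace_eq_sum_inner _ (EuclideanSpace.basisFun ι 𝕜)]
  simp [EuclideanSpace.inner_single_left]

lemma starProjection_single_apply_of_map_eq {σ : Equiv.Perm ι}
    (hσ : W.map (LinearIsometryEquiv.piLpCongrLeft 2 𝕜 𝕜 σ).toLinearEquiv.toLinearMap = W)
    (i : ι) :
    W.starProjection (EuclideanSpace.single (σ i) 1) (σ i)
      = W.starProjection (EuclideanSpace.single i 1) i := by
  have h := Submodule.starProjection_map_apply (LinearIsometryEquiv.piLpCongrLeft 2 𝕜 𝕜 σ) W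
    (EuclideanSpace.single (σ i) 1)
  simp only [hσ, LinearIsometryEquiv.piLpCongrLeft_symm, EuclideanSpace.piLpCongrLeft_single,
    Equiv.symm_apply_apply] at h
  rw [h]
  simp [LinearIsometryEquiv.piLpCongrLeft_apply, Equiv.piCongrLeft']

lemma starProjection_single_apply_of_transitive
    (h : ∀ i j, ∃ σ : Equiv.Perm ι, σ i = j ∧
      W.map (LinearIsometryEquiv.piLpCongrLeft 2 𝕜 𝕜 σ).toLinearEquiv.toLinearMap = W) (i : ι) :
    W.starProjection (EuclideanSpace.single i 1) i = Module.finrank 𝕜 W / Fintype.card ι := by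
  have hconst : ∀ j, W.starProjection (EuclideanSpace.single j 1) j
      = W.starProjection (EuclideanSpace.single i 1) i := by
    intro j
    obtain ⟨σ, rfl, hσ⟩ := h i j
    exact starProjection_single_apply_of_map_eq W hσ i
  have : Nonempty ι := ⟨i⟩
  rw [← sum_starProjection_single_apply, Fintype.sum_congr _ _ hconst, Finset.sum_const,
    Finset.card_univ, nsmul_eq_mul, mul_div_cancel_left₀ _ (by simp)]

end TransitiveSubspace

section InclusionMatrices

variable {v s t k r j : ℕ}

/-- Wilson's inclusion matrix `W_{s,t}` between the `s`-subsets and the `t`-subsets of a `v`-set. -/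
def inclMatrix (R : Type*) [Zero R] [One R] (v s t : ℕ) : Matrix (TSet v s) (TSet v t) R :=
  Matrix.of fun S T => if S.1 ⊆ T.1 then 1 else 0

lemma card_tset (v t : ℕ) : Fintype.card (TSet v t) = v.choose t := by
  simp [Fintype.card_finset_len]

lemma card_filter_tset (p : Finset (Fin v) → Prop) [DecidablePred p] :
    (Finset.univ.filter fun T : TSet v t => p T.1).card
      = ((Finset.univ.powersetCard t).filter p).card := by
  refine Finset.card_bij (fun T _ => T.1) (fun T hT => ?_)
    (fun _ _ _ _ => Subtype.ext) fun T hT => ?_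
  · simpa [T.2] using hT
  · simp only [Finset.mem_filter, Finset.mem_powersetCard] at hT
    exact ⟨⟨T, hT.1.2⟩, by simpa using hT.2, rfl⟩

lemma card_filter_subset_tset_subset {D K : Finset (Fin v)} (hDK : D ⊆ K) (hD : D.card ≤ t) :
    (Finset.univ.filter fun T : TSet v t => D ⊆ T.1 ∧ T.1 ⊆ K).card
      = (K.card - D.card).choose (t - D.card) := by
  rw [card_filter_tset fun T => D ⊆ T ∧ T ⊆ K,
    ← Finset.card_filter_powersetCard_subset D K t hDK hD]
  congr 1
  ext T
  simp [and_comm, and_left_comm]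

lemma card_filter_subset_tset (D : Finset (Fin v)) (ht : t ≤ v) :
    (Finset.univ.filter fun T : TSet v t => D ⊆ T.1).card = (v - D.card).choose (v - t) := by
  rcases le_or_gt D.card t with hD | hD
  · have h := card_filter_subset_tset_subset D.subset_univ hD
    rw [Finset.card_fin, Nat.choose_symm_of_eq_add (b := v - t) (by omega)] at h
    simpa only [Finset.subset_univ, and_true] using h
  · have := card_finset_fin_le D
    rw [Nat.choose_eq_zero_of_lt (by omega), Finset.card_eq_zero, Finset.filter_eq_empty_iff]
    exact fun T _ hDT => hD.not_ge (T.2 ▸ Finset.card_le_card hDT)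

variable {R : Type*} [CommRing R]

lemma inclMatrix_eq_zero (hts : t < s) : inclMatrix R v s t = 0 := by
  ext S T
  exact if_neg fun h => hts.not_ge (S.2 ▸ T.2 ▸ Finset.card_le_card h)

lemma inclMatrix_self : inclMatrix R v t t = 1 := by
  ext S T
  have : S.1 ⊆ T.1 ↔ S = T :=
    ⟨fun h => Subtype.ext (Finset.eq_of_subset_of_card_le h (by rw [S.2, T.2])),
      fun h => h ▸ subset_rfl⟩
  simp only [inclMatrix, Matrix.of_apply, Matrix.one_apply, this]

lemma inclMatrix_mul_inclMatrix (hst : s ≤ t) :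
    inclMatrix R v s t * inclMatrix R v t k
      = ((k - s).choose (t - s) : R) • inclMatrix R v s k := by
  ext S K
  simp only [inclMatrix, Matrix.mul_apply, Matrix.of_apply, Matrix.smul_apply,
    ite_zero_mul_ite_zero, mul_one, smul_eq_mul, Finset.sum_boole]
  split_ifs with hSK
  · rw [card_filter_subset_tset_subset hSK (S.2.trans_le hst), S.2, K.2, mul_one]
  · rw [Finset.filter_false_of_mem fun T _ h => hSK (h.1.trans h.2), Finset.card_empty,
      Nat.cast_zero, mul_zero]

lemma inclMatrix_mul_transpose_apply (htv : t ≤ v) (S : TSet v r) (Z : TSet v j) :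
    (inclMatrix R v r t * (inclMatrix R v j t).transpose) S Z
      = (v - (S.1 ∪ Z.1).card).choose (v - t) := by
  simp only [inclMatrix, Matrix.mul_apply, Matrix.of_apply, Matrix.transpose_apply,
    ite_zero_mul_ite_zero, mul_one, Finset.sum_boole, ← Finset.union_subset_iff]
  rw [card_filter_subset_tset _ htv]

lemma transpose_inclMatrix_mul_apply (S : TSet v r) (Z : TSet v j) :
    ((inclMatrix R v s r).transpose * inclMatrix R v s j) S Z = (S.1 ∩ Z.1).card.choose s := by
  simp only [inclMatrix, Matrix.mul_apply, Matrix.of_apply, Matrix.transpose_apply,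
    ite_zero_mul_ite_zero, mul_one, Finset.sum_boole, ← Finset.subset_inter_iff]
  have h := card_filter_subset_tset_subset (t := s) (S.1 ∩ Z.1).empty_subset (by simp)
  simp only [Finset.empty_subset, true_and, Finset.card_empty, Nat.sub_zero] at h
  rw [h]

lemma inclMatrix_mul_transpose (hrj : r + j ≤ v) (htv : t ≤ v) :
    inclMatrix R v r t * (inclMatrix R v j t).transpose
      = ∑ l ∈ Finset.range (v - t + 1), ((v - r - j).choose (v - t - l) : R) •
          ((inclMatrix R v l r).transpose * inclMatrix R v l j) := by
  ext S Z
  have hcard := Finset.card_union_add_card_inter S.1 Z.1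
  rw [S.2, Z.2] at hcard
  have hunion : v - (S.1 ∪ Z.1).card = (S.1 ∩ Z.1).card + (v - r - j) := by omega
  rw [inclMatrix_mul_transpose_apply htv, hunion, Nat.add_choose_eq,
    Finset.Nat.sum_antidiagonal_eq_sum_range_succ_mk]
  simp only [Nat.succ_eq_add_one, Matrix.sum_apply, Matrix.smul_apply,
    transpose_inclMatrix_mul_apply, smul_eq_mul, Nat.cast_sum, Nat.cast_mul, mul_comm]

end InclusionMatrices

section Harmonic

variable {K : Type*} [Field K] {v s t r j : ℕ}

/-- The harmonic functions on the `j`-subsets: those whose sum over the `j`-subsets containing any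
given `(j - 1)`-subset vanishes. -/
def harmonicSpace (K : Type*) [Field K] (v : ℕ) : (j : ℕ) → Submodule K (TSet v j → K)
  | 0 => ⊤
  | j + 1 => LinearMap.ker (inclMatrix K v j (j + 1)).mulVecLin

lemma mult_le_finrank_harmonicSpace (v j : ℕ) :
    mult v j ≤ Module.finrank K (harmonicSpace K v j) := by
  cases j with
  | zero => rw [mult, harmonicSpace, finrank_top, Module.finrank_fintype_fun_eq_card, card_tset,
      Nat.choose_zero_right]
  | succ j =>
    have hker := (inclMatrix K v j (j + 1)).mulVecLin.finrank_range_add_finrank_ker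
    have hrange := (LinearMap.range (inclMatrix K v j (j + 1)).mulVecLin).finrank_le
    simp only [Module.finrank_fintype_fun_eq_card, card_tset] at hker hrange
    rw [mult, harmonicSpace]
    omega

variable [CharZero K] {y : TSet v j → K}

open Matrix

lemma inclMatrix_mulVec_eq_zero (hy : y ∈ harmonicSpace K v j) (hs : s < j) :
    inclMatrix K v s j *ᵥ y = 0 := by
  cases j with
  | zero => omega
  | succ j =>
    have hzero : inclMatrix K v j (j + 1) *ᵥ y = 0 := hy
    have h := congrArg (· *ᵥ y) (inclMatrix_mul_inclMatrix (R := K) (v := v) (k := j + 1)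
      (Nat.lt_succ_iff.1 hs))
    simp only [← mulVec_mulVec, hzero, mulVec_zero, smul_mulVec] at h
    exact (smul_eq_zero.1 h.symm).resolve_left
      (Nat.cast_ne_zero.2 (Nat.choose_pos (by omega)).ne')

lemma inclMatrix_mulVec_transpose_mulVec (hy : y ∈ harmonicSpace K v j) (hrj : r + j ≤ v)
    (hrt : r ≤ t) (htv : t ≤ v) :
    inclMatrix K v r t *ᵥ ((inclMatrix K v j t)ᵀ *ᵥ y)
      = ((v - r - j).choose (t - r) : K) • ((inclMatrix K v j r)ᵀ *ᵥ y) := by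
  rw [mulVec_mulVec, inclMatrix_mul_transpose hrj htv, sum_mulVec]
  have hterm : ∀ l, ((v - r - j).choose (v - t - l) : K) •
      (inclMatrix K v l r)ᵀ *ᵥ (inclMatrix K v l j *ᵥ y)
      = if l = j then ((v - r - j).choose (v - t - j) : K) • (inclMatrix K v j r)ᵀ *ᵥ y else 0 := by
    intro l
    rcases lt_trichotomy l j with h | rfl | h
    · rw [inclMatrix_mulVec_eq_zero hy h, mulVec_zero, smul_zero, if_neg h.ne]
    · rw [inclMatrix_self, one_mulVec, if_pos rfl]
    · rw [inclMatrix_eq_zero h, zero_mulVec, mulVec_zero, smul_zero, if_neg h.ne']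
  simp only [smul_mulVec, ← mulVec_mulVec, hterm]
  rw [Finset.sum_ite_eq']
  split_ifs with h <;> rw [Finset.mem_range] at h
  · rw [Nat.choose_symm_of_eq_add (b := t - r) (by omega)]
  · rw [Nat.choose_eq_zero_of_lt (by omega : v - r - j < t - r), Nat.cast_zero, zero_smul]

lemma eq_zero_of_transpose_inclMatrix_mulVec_eq_zero (hy : y ∈ harmonicSpace K v j) (hjt : j ≤ t)
    (hjv : j + t ≤ v) (h : (inclMatrix K v j t)ᵀ *ᵥ y = 0) : y = 0 := by
  have hlift := inclMatrix_mulVec_transpose_mulVec (t := t) hy (by omega) hjt (by omega)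
  rw [h, mulVec_zero, inclMatrix_self, transpose_one, one_mulVec] at hlift
  exact (smul_eq_zero.1 hlift.symm).resolve_left
    (Nat.cast_ne_zero.2 (Nat.choose_pos (by omega)).ne')

end Harmonic

section JohnsonScheme

open Matrix

variable {v t k i j : ℕ}

lemma sum_alternating_choose_mul_choose {m : ℕ} (hi : i ≤ t) (hm : m ≤ t) :
    ∑ s ∈ Finset.range (i + 1),
      (-1 : ℤ) ^ (i - s) * (t - s).choose (i - s) * m.choose (t - s)
      = if m + i = t then 1 else 0 := by
  have hterm : ∀ s ∈ Finset.range (i + 1),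
      (-1 : ℤ) ^ (i - s) * (t - s).choose (i - s) * m.choose (t - s)
      = m.choose (t - i) * ((-1) ^ (i - s) * (m - (t - i)).choose (i - s)) := by
    intro s hs
    rw [Finset.mem_range] at hs
    have h := Nat.choose_mul (n := m) (k := t - s) (s := t - i) (by omega)
    rw [Nat.choose_symm_of_eq_add (a := t - i) (b := i - s) (by omega),
      show t - s - (t - i) = i - s by omega] at h
    have hcast := congrArg (Nat.cast : ℕ → ℤ) h
    push_cast at hcast
    linear_combination (-1 : ℤ) ^ (i - s) * hcast
  have hreflect := Finset.sum_range_reflect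
    (fun l => (-1 : ℤ) ^ l * (m - (t - i)).choose l) (i + 1)
  rw [Nat.add_sub_cancel] at hreflect
  rw [Finset.sum_congr rfl hterm, ← Finset.mul_sum, hreflect]
  rcases lt_trichotomy (m + i) t with h | h | h
  · rw [Nat.choose_eq_zero_of_lt (by omega), if_neg h.ne, Nat.cast_zero, zero_mul]
  · rw [if_pos h, ← h, Nat.add_sub_cancel, Nat.sub_self, Nat.choose_self, Finset.sum_range_succ']
    simp
  · obtain ⟨d, hd⟩ : ∃ d, m - (t - i) = d + 1 := ⟨m - (t - i) - 1, by omega⟩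
    rw [hd, Int.alternating_sum_range_choose_eq_choose,
      Nat.choose_eq_zero_of_lt (by omega : d < i), if_neg h.ne', Nat.cast_zero, mul_zero, mul_zero]

lemma johnsonA_eq_sum (hi : i ≤ t) :
    johnsonA v t i = ∑ s ∈ Finset.range (i + 1), ((-1) ^ (i - s) * (t - s).choose (i - s) : ℝ) •
      ((inclMatrix ℝ v (t - s) t)ᵀ * inclMatrix ℝ v (t - s) t) := by
  ext S T
  have hinter : (S.1 ∩ T.1).card ≤ t :=
    (Finset.card_le_card Finset.inter_subset_left).trans S.2.le
  simp only [johnsonA, of_apply, Matrix.sum_apply, Matrix.smul_apply,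
    transpose_inclMatrix_mul_apply, smul_eq_mul]
  exact_mod_cast congrArg (Int.cast : ℤ → ℝ) (sum_alternating_choose_mul_choose hi hinter).symm

lemma covM_eq_inclMatrix_mul_transpose (hk : 2 * t ≤ k) (hv : k ≤ v) :
    covM v t k = inclMatrix ℝ v t k * (inclMatrix ℝ v t k)ᵀ := by
  ext S T
  have hdiff := (Finset.card_le_card (Finset.sdiff_subset (s := S.1) (t := T.1))).trans S.2.le
  have hunion : (S.1 ∪ T.1).card = t + (S.1 \ T.1).card := by
    rw [← Finset.sdiff_union_self_eq_union, Finset.card_union_of_disjoint Finset.sdiff_disjoint,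
      T.2, add_comm]
  rw [inclMatrix_mul_transpose_apply hv, hunion, covM, of_apply, xi, ← Nat.sub_sub,
    Nat.choose_symm_of_eq_add (b := v - k) (by omega)]

lemma covM_eq_sum (v t k : ℕ) :
    covM v t k = ∑ i ∈ Finset.range (t + 1), (xi v t k i : ℝ) • johnsonA v t i := by
  ext S T
  have hcard := Finset.card_sdiff_add_card_inter S.1 T.1
  rw [S.2] at hcard
  simp only [Matrix.sum_apply, Matrix.smul_apply, johnsonA, of_apply, smul_eq_mul, covM]
  rw [Finset.sum_eq_single (S.1 \ T.1).card]
  · rw [if_pos (by omega), mul_one]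
  · intro i _ hi
    rw [if_neg (by omega), mul_zero]
  · intro hn
    exact absurd (Finset.mem_range.2 (by omega)) hn

lemma johnsonA_mulVec_transpose_inclMatrix_mulVec {y : TSet v j → ℝ}
    (hy : y ∈ harmonicSpace ℝ v j) (hi : i ≤ t) (hjt : j ≤ t) (hjv : j + t ≤ v) :
    johnsonA v t i *ᵥ ((inclMatrix ℝ v j t)ᵀ *ᵥ y)
      = johnsonP v t i j • ((inclMatrix ℝ v j t)ᵀ *ᵥ y) := by
  rw [johnsonA_eq_sum hi, sum_mulVec, johnsonP, Finset.sum_smul]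
  refine Finset.sum_congr rfl fun s hs => ?_
  have hst : s ≤ t := (Finset.mem_range_succ_iff.1 hs).trans hi
  rw [smul_mulVec, ← mulVec_mulVec, inclMatrix_mulVec_transpose_mulVec hy (by omega) (t.sub_le s)
    (by omega), mulVec_smul, mulVec_mulVec, ← transpose_mul, Nat.sub_sub_self hst,
    show v - (t - s) - j = v - t + s - j by omega]
  rcases le_or_gt j (t - s) with hjs | hjs
  · rw [inclMatrix_mul_inclMatrix hjs, transpose_smul, smul_mulVec, smul_smul, smul_smul,
      Nat.choose_symm_of_eq_add (a := t - s - j) (b := s) (by omega)]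
    congr 1
    ring
  · rw [inclMatrix_eq_zero hjs, Matrix.zero_mul, transpose_zero, zero_mulVec, smul_zero, smul_zero,
      Nat.choose_eq_zero_of_lt (by omega : t - j < s), Nat.cast_zero, mul_zero, zero_mul, zero_smul]

lemma covM_mulVec_transpose_inclMatrix_mulVec {y : TSet v j → ℝ} (hy : y ∈ harmonicSpace ℝ v j)
    (hjt : j ≤ t) (hk : 2 * t ≤ k) (hv : k ≤ v) :
    covM v t k *ᵥ ((inclMatrix ℝ v j t)ᵀ *ᵥ y)
      = ((k - j).choose (t - j) * (v - t - j).choose (k - t) : ℝ) •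
          ((inclMatrix ℝ v j t)ᵀ *ᵥ y) := by
  rw [covM_eq_inclMatrix_mul_transpose hk hv, ← mulVec_mulVec, mulVec_mulVec _ _ᵀ, ← transpose_mul,
    inclMatrix_mul_inclMatrix hjt, transpose_smul, smul_mulVec, mulVec_smul,
    inclMatrix_mulVec_transpose_mulVec hy (by omega) (by omega) hv, smul_smul]

lemma mem_johnsonSpace {x : EuclideanSpace ℝ (TSet v t)} :
    x ∈ johnsonSpace v t j ↔ ∀ i ≤ t, johnsonA v t i *ᵥ x.ofLp = johnsonP v t i j • x.ofLp := by
  simp only [johnsonSpace, Submodule.mem_iInf, Module.End.mem_eigenspace_iff, Fin.forall_iff,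
    Nat.lt_succ_iff, ← (WithLp.ofLp_injective 2).eq_iff, ofLp_toLpLin, toLin'_apply,
    WithLp.ofLp_smul]

lemma covM_mulVec_of_mem_johnsonSpace {x : EuclideanSpace ℝ (TSet v t)}
    (hx : x ∈ johnsonSpace v t j) (k : ℕ) :
    covM v t k *ᵥ x.ofLp = theta v t k j • x.ofLp := by
  rw [covM_eq_sum, sum_mulVec, theta, Finset.sum_smul]
  refine Finset.sum_congr rfl fun i hi => ?_
  rw [smul_mulVec, mem_johnsonSpace.1 hx i (Finset.mem_range_succ_iff.1 hi), smul_smul]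

lemma toLp_transpose_inclMatrix_mulVec_mem_johnsonSpace {y : TSet v j → ℝ}
    (hy : y ∈ harmonicSpace ℝ v j) (hjt : j ≤ t) (hjv : j + t ≤ v) :
    WithLp.toLp 2 ((inclMatrix ℝ v j t)ᵀ *ᵥ y) ∈ johnsonSpace v t j :=
  mem_johnsonSpace.2 fun _ hi => johnsonA_mulVec_transpose_inclMatrix_mulVec hy hi hjt hjv

lemma mult_le_finrank_johnsonSpace (hjt : j ≤ t) (hjv : j + t ≤ v) :
    mult v j ≤ Module.finrank ℝ (johnsonSpace v t j) := by
  let lift : harmonicSpace ℝ v j →ₗ[ℝ] johnsonSpace v t j :=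
    ((WithLp.linearEquiv 2 ℝ _).symm.toLinearMap ∘ₗ (inclMatrix ℝ v j t)ᵀ.mulVecLin).restrict
      fun _ hy => toLp_transpose_inclMatrix_mulVec_mem_johnsonSpace hy hjt hjv
  have hlift : Function.Injective lift := by
    refine (injective_iff_map_eq_zero lift).2 fun y hy => Subtype.ext ?_
    exact eq_zero_of_transpose_inclMatrix_mulVec_eq_zero y.2 hjt hjv
      (congrArg (fun x => x.1.ofLp) hy)
  exact (mult_le_finrank_harmonicSpace v j).trans (LinearMap.finrank_le_finrank_of_injective hlift)

lemma choose_lt_choose_succ (h : 2 * (j + 1) ≤ v) : v.choose j < v.choose (j + 1) := by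
  have hsucc := Nat.choose_succ_right_eq v j
  have hpos : 0 < v.choose j := Nat.choose_pos (by omega)
  have hfactor : j + 1 < v - j := by omega
  by_contra! hle
  exact (Nat.mul_lt_mul_of_le_of_lt hle hfactor hpos).ne hsucc

lemma mult_pos (h : 2 * j ≤ v) : 0 < mult v j := by
  cases j with
  | zero => exact Nat.one_pos
  | succ j => exact Nat.sub_pos_of_lt (choose_lt_choose_succ h)

lemma sum_mult (h : 2 * t ≤ v) : ∑ j : Fin (t + 1), mult v j = v.choose t := by
  induction t with
  | zero => simp [mult]
  | succ t ih =>
    rw [Fin.sum_univ_castSucc]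
    simp only [Fin.val_castSucc, Fin.val_last]
    rw [ih (by omega), mult, Nat.add_sub_cancel' (choose_lt_choose_succ h).le]

lemma theta_eq (hk : 2 * t ≤ k) (hv : k ≤ v) (hjt : j ≤ t) :
    theta v t k j = (k - j).choose (t - j) * (v - t - j).choose (k - t) := by
  obtain ⟨⟨y, hy⟩, hne⟩ := Module.finrank_pos_iff_exists_ne_zero.1
    ((mult_pos (v := v) (j := j) (by omega)).trans_le (mult_le_finrank_harmonicSpace (K := ℝ) v j))
  have hlift : (inclMatrix ℝ v j t)ᵀ *ᵥ y ≠ 0 := fun h => hne <| Subtype.ext <|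
    eq_zero_of_transpose_inclMatrix_mulVec_eq_zero hy hjt (by omega) h
  refine smul_left_injective ℝ hlift ?_
  exact (covM_mulVec_of_mem_johnsonSpace
    (toLp_transpose_inclMatrix_mulVec_mem_johnsonSpace hy hjt (by omega)) k).symm.trans
    (covM_mulVec_transpose_inclMatrix_mulVec hy hjt hk hv)

lemma theta_pos (hk : 2 * t ≤ k) (hv : k + j ≤ v) (hjt : j ≤ t) : 0 < theta v t k j := by
  have hleft : 0 < (k - j).choose (t - j) := Nat.choose_pos (by omega)
  have hright : 0 < (v - t - j).choose (k - t) := Nat.choose_pos (by omega)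
  rw [theta_eq hk (by omega) hjt]
  positivity

end JohnsonScheme

section Decomposition

open Matrix

variable {v t i j : ℕ}

lemma johnsonP_one (hv : 2 * t ≤ v) (hj : j ≤ t) :
    johnsonP v t 1 j = ((t : ℝ) - j) * ((v : ℝ) - t + 1 - j) - t := by
  simp only [johnsonP, Finset.sum_range_succ, Finset.sum_range_zero, Nat.choose_zero_right,
    Nat.sub_zero, Nat.sub_self, Nat.choose_one_right, pow_one, pow_zero, Nat.cast_one]
  push_cast [hj, (by omega : j ≤ v - t + 1), (by omega : t ≤ v)]
  ring

lemma johnsonP_one_injOn (hv : 2 * t ≤ v) : Set.InjOn (johnsonP v t 1) (Set.Iic t) := by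
  intro i hi j hj hij
  rw [Set.mem_Iic] at hi hj
  rw [johnsonP_one hv hi, johnsonP_one hv hj] at hij
  have hfactor : ((i : ℝ) - j) * ((v : ℝ) + 1 - (i + j)) = 0 := by linear_combination -hij
  by_contra hne
  rcases mul_eq_zero.1 hfactor with h | h
  · exact hne (by exact_mod_cast sub_eq_zero.1 h)
  · have hsum : v + 1 = i + j := by exact_mod_cast sub_eq_zero.1 h
    omega

lemma johnsonA_isHermitian (v t i : ℕ) : (johnsonA v t i).IsHermitian := by
  ext S T
  simp [johnsonA, Finset.inter_comm]

lemma orthogonalFamily_johnsonSpace (hv : 2 * t ≤ v) :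
    OrthogonalFamily ℝ (fun j : Fin (t + 1) => johnsonSpace v t j)
      fun j => (johnsonSpace v t j).subtypeₗᵢ := by
  refine OrthogonalFamily.of_pairwise fun i j hij x hx y hy => ?_
  have ht : 1 < t + 1 := by omega
  have hmem : ∀ l : Fin (t + 1), johnsonSpace v t l ≤
      Module.End.eigenspace (toEuclideanLin (johnsonA v t 1)) (johnsonP v t 1 l) :=
    fun l => iInf_le _ (⟨1, ht⟩ : Fin (t + 1))
  have hne : johnsonP v t 1 i ≠ johnsonP v t 1 j :=
    (johnsonP_one_injOn hv).ne i.is_le j.is_le (Fin.val_ne_of_ne hij)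
  exact (isSymmetric_toEuclideanLin_iff.2
    (johnsonA_isHermitian v t 1)).orthogonalFamily_eigenspaces.isOrtho hne (hmem i hx) y (hmem j hy)

lemma finrank_johnsonSpace_and_isInternal (hv : 2 * t ≤ v) :
    (∀ j : Fin (t + 1), Module.finrank ℝ (johnsonSpace v t j) = mult v j) ∧
      DirectSum.IsInternal fun j : Fin (t + 1) => johnsonSpace v t j := by
  refine finrank_eq_and_isInternal_of_sum_eq_finrank
    (orthogonalFamily_johnsonSpace hv).independent
    (fun j => mult_le_finrank_johnsonSpace j.is_le (by omega)) ?_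
  rw [sum_mult hv, finrank_euclideanSpace, card_tset]

lemma charpoly_covM (k : ℕ) (hv : 2 * t ≤ v) :
    (covM v t k).charpoly = ∏ j : Fin (t + 1), (X - C (theta v t k j)) ^ mult v j := by
  obtain ⟨hfinrank, hint⟩ := finrank_johnsonSpace_and_isInternal hv
  have h := charpoly_eq_prod_of_isInternal hint (f := toEuclideanLin (covM v t k))
    (θ := fun j => theta v t k j) fun j x hx =>
      WithLp.ofLp_injective 2 (covM_mulVec_of_mem_johnsonSpace hx k)
  simpa only [toEuclideanLin, toLpLin_eq_toLin, charpoly_toLin, hfinrank] using h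

lemma one_mem_johnsonSpace_zero (hv : t ≤ v) :
    WithLp.toLp 2 (1 : TSet v t → ℝ) ∈ johnsonSpace v t 0 := by
  have hones : (inclMatrix ℝ v 0 t)ᵀ *ᵥ 1 = 1 := by
    ext S
    have hcard := card_filter_subset_tset_subset (t := 0) (Finset.empty_subset S.1) le_rfl
    simpa [mulVec, dotProduct, inclMatrix] using hcard
  rw [← hones]
  exact toLp_transpose_inclMatrix_mulVec_mem_johnsonSpace (by simp [harmonicSpace]) t.zero_le
    (by omega)

lemma starProjection_johnsonSpace_one (hv : 2 * t ≤ v) (j : Fin (t + 1)) :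
    (johnsonSpace v t j).starProjection (WithLp.toLp 2 1)
      = if j = 0 then WithLp.toLp 2 1 else 0 := by
  have hone := one_mem_johnsonSpace_zero (v := v) (t := t) (by omega)
  split_ifs with h
  · subst h
    exact Submodule.starProjection_eq_self_iff.2 hone
  · exact (Submodule.starProjection_apply_eq_zero_iff _).2
      ((orthogonalFamily_johnsonSpace hv).isOrtho (Ne.symm h) hone)

lemma covM_mulVec_eq_sum (hv : 2 * t ≤ v) (k : ℕ) (x : EuclideanSpace ℝ (TSet v t)) :
    covM v t k *ᵥ x.ofLp = ∑ j : Fin (t + 1),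
      theta v t k j • ((johnsonSpace v t j).starProjection x).ofLp := by
  have hsum : ∑ j : Fin (t + 1), (johnsonSpace v t j).starProjection x = x := by
    refine (orthogonalFamily_johnsonSpace hv).sum_projection_of_mem_iSup x ?_
    rw [(finrank_johnsonSpace_and_isInternal hv).2.submodule_iSup_eq_top]
    exact Submodule.mem_top
  nth_rw 1 [← hsum]
  rw [WithLp.ofLp_sum, mulVec_sum]
  exact Finset.sum_congr rfl fun j _ =>
    covM_mulVec_of_mem_johnsonSpace (Submodule.starProjection_apply_mem _ _) k

end Decomposition

section Symmetry

open Matrix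

variable {v t j : ℕ}

/-- The action of a permutation of the points on the `t`-sets. -/
def permTSet (t : ℕ) (σ : Equiv.Perm (Fin v)) : Equiv.Perm (TSet v t) :=
  σ.finsetCongr.subtypeEquiv fun S => by simp

lemma exists_permTSet_eq (S T : TSet v t) : ∃ σ, permTSet t σ S = T := by
  have hcard : Fintype.card S.1 = Fintype.card T.1 := by simp [S.2, T.2]
  let e : S.1 ≃ T.1 := Fintype.equivOfCardEq hcard
  refine ⟨e.extendSubtype, Subtype.ext <| Finset.eq_of_subset_of_card_le ?_ ?_⟩
  · intro x hx
    obtain ⟨y, hy, rfl⟩ := Finset.mem_map.1 hx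
    exact e.extendSubtype_mem y hy
  · rw [T.2, (permTSet t _ S).2]

lemma johnsonA_submatrix_permTSet (i : ℕ) (σ : Equiv.Perm (Fin v)) :
    (johnsonA v t i).submatrix (permTSet t σ) (permTSet t σ) = johnsonA v t i := by
  ext S T
  simp only [submatrix_apply, johnsonA, of_apply, permTSet, Equiv.subtypeEquiv_apply,
    Equiv.finsetCongr_apply, ← Finset.map_inter, Finset.card_map]

lemma map_permTSet_johnsonSpace (σ : Equiv.Perm (Fin v)) :
    (johnsonSpace v t j).map (LinearIsometryEquiv.piLpCongrLeft 2 ℝ ℝ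
      (permTSet t σ)).toLinearEquiv.toLinearMap = johnsonSpace v t j := by
  refine Submodule.eq_of_le_of_finrank_eq ?_ (LinearEquiv.finrank_map_eq _ _)
  rintro _ ⟨x, hx, rfl⟩
  refine mem_johnsonSpace.2 fun i hi => ?_
  have hcomm := submatrix_mulVec_equiv (johnsonA v t i) x.ofLp (permTSet t σ) (permTSet t σ)
  rw [johnsonA_submatrix_permTSet, mem_johnsonSpace.1 hx i hi, ← Equiv.comp_symm_eq] at hcomm
  exact hcomm.symm

lemma starProjection_johnsonSpace_single_apply (hv : 2 * t ≤ v) (T₀ : TSet v t)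
    (j : Fin (t + 1)) :
    (johnsonSpace v t j).starProjection (EuclideanSpace.single T₀ 1) T₀
      = mult v j / v.choose t := by
  rw [starProjection_single_apply_of_transitive, (finrank_johnsonSpace_and_isInternal hv).1,
    card_tset]
  intro S T
  obtain ⟨σ, hσ⟩ := exists_permTSet_eq S T
  exact ⟨permTSet t σ, hσ, map_permTSet_johnsonSpace σ⟩

end Symmetry

section Compression

open Matrix

variable {v t k : ℕ} (T₀ : TSet v t)

/-- The column of `E_j` indexed by `T₀`; normalizing it gives `e^{(j)}`. -/
noncomputable def projCol (j : ℕ) : EuclideanSpace ℝ (TSet v t) :=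
  (johnsonSpace v t j).starProjection (EuclideanSpace.single T₀ 1)

lemma projCol_mem (j : ℕ) : projCol T₀ j ∈ johnsonSpace v t j :=
  Submodule.starProjection_apply_mem _ _

lemma unitE_eq_smul_projCol (j : ℕ) : unitE T₀ j = ‖projCol T₀ j‖⁻¹ • projCol T₀ j := rfl

lemma unitE_mem (j : ℕ) : unitE T₀ j ∈ johnsonSpace v t j :=
  Submodule.smul_mem _ _ (projCol_mem T₀ j)

lemma projCol_apply_self (hv : 2 * t ≤ v) (j : Fin (t + 1)) :
    projCol T₀ j T₀ = mult v j / v.choose t :=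
  starProjection_johnsonSpace_single_apply hv T₀ j

lemma norm_projCol (hv : 2 * t ≤ v) (j : Fin (t + 1)) :
    ‖projCol T₀ j‖ = √(mult v j / v.choose t) := by
  rw [← projCol_apply_self T₀ hv, projCol, ← inner_starProjection_single_self,
    real_inner_self_eq_norm_sq, Real.sqrt_sq (norm_nonneg _)]

lemma norm_projCol_pos (hv : 2 * t ≤ v) (j : Fin (t + 1)) : 0 < ‖projCol T₀ j‖ := by
  have hm : 0 < mult v j := mult_pos (by omega)
  have hn : 0 < v.choose t := Nat.choose_pos (by omega)
  rw [norm_projCol T₀ hv]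
  positivity

lemma inner_projCol_one (hv : 2 * t ≤ v) (j : Fin (t + 1)) :
    inner ℝ (projCol T₀ j) (WithLp.toLp 2 1) = if j = 0 then 1 else 0 := by
  rw [projCol, Submodule.inner_starProjection_left_eq_right, starProjection_johnsonSpace_one hv]
  split_ifs <;> simp [EuclideanSpace.inner_single_left]

lemma orthonormal_unitE (hv : 2 * t ≤ v) :
    Orthonormal ℝ fun j : Fin (t + 1) => unitE T₀ j := by
  refine ⟨fun j => ?_, fun i j hij =>
    (orthogonalFamily_johnsonSpace hv).isOrtho hij.symm (unitE_mem T₀ j) _ (unitE_mem T₀ i)⟩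
  simp only [unitE_eq_smul_projCol, norm_smul, norm_inv, norm_norm]
  exact inv_mul_cancel₀ (norm_projCol_pos T₀ hv j).ne'

lemma transpose_matV_mul_matV (hv : 2 * t ≤ v) : (matV T₀)ᵀ * matV T₀ = 1 := by
  ext i j
  rw [one_apply, ← orthonormal_iff_ite.1 (orthonormal_unitE T₀ hv) i j,
    EuclideanSpace.inner_eq_star_dotProduct, star_trivial, dotProduct_comm]
  rfl

lemma covM_mul_matV (k : ℕ) : covM v t k * matV T₀ = matV T₀ * matTheta v t k := by
  ext S j
  rw [matTheta, mul_diagonal, mul_comm]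
  exact congrFun (covM_mulVec_of_mem_johnsonSpace (unitE_mem T₀ j) k) S

lemma covM_isSymm (v t k : ℕ) : (covM v t k).IsSymm := by
  rw [covM_eq_sum]
  refine IsSymm.ext fun S T => ?_
  simp [Matrix.sum_apply, johnsonA, Finset.inter_comm]

lemma transpose_matV_mul_covM (k : ℕ) :
    (matV T₀)ᵀ * covM v t k = matTheta v t k * (matV T₀)ᵀ := by
  have h := congrArg transpose (covM_mul_matV T₀ k)
  rwa [transpose_mul, transpose_mul, (covM_isSymm v t k).eq, matTheta, diagonal_transpose] at h

lemma matB_eq : matB T₀ = 1 + vecMulVec (1 - Pi.single T₀ 1) (Pi.single T₀ 1) := by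
  ext S T
  by_cases hT : T = T₀ <;> by_cases hS : S = T₀ <;>
    simp [matB, one_apply, vecMulVec_apply, hT, hS]

lemma transpose_matV_mulVec_one (hv : 2 * t ≤ v) :
    (matV T₀)ᵀ *ᵥ 1 = Pi.single 0 √(v.choose t) := by
  ext j
  have hinner : ((matV T₀)ᵀ *ᵥ 1) j = ‖projCol T₀ j‖⁻¹ * if j = 0 then 1 else 0 := by
    rw [← inner_projCol_one T₀ hv, ← real_inner_smul_left, ← unitE_eq_smul_projCol,
      EuclideanSpace.inner_eq_star_dotProduct, star_trivial, dotProduct_comm]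
    rfl
  rw [hinner, norm_projCol T₀ hv, Pi.single_apply]
  split_ifs with h <;> simp [h, mult]

lemma matV_apply_self (hv : 2 * t ≤ v) (j : Fin (t + 1)) :
    matV T₀ T₀ j = √(mult v j / v.choose t) := by
  change ‖projCol T₀ j‖⁻¹ * projCol T₀ j T₀ = _
  rw [norm_projCol T₀ hv, projCol_apply_self T₀ hv, inv_mul_eq_div, Real.div_sqrt]

lemma matR_eq (hv : 2 * t ≤ v) :
    matR k T₀ = matTheta v t k * (1 + vecMulVec
      (fun i : Fin (t + 1) => (if i = 0 then 1 else 0) - √(mult v i : ℝ) / (v.choose t : ℝ))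
      (fun j : Fin (t + 1) => √(mult v j : ℝ))) := by
  have hcompress : (matV T₀)ᵀ * matB T₀ * matV T₀
      = 1 + vecMulVec ((matV T₀)ᵀ *ᵥ (1 - Pi.single T₀ 1)) (Pi.single T₀ 1 ᵥ* matV T₀) := by
    rw [matB_eq, Matrix.mul_add, Matrix.add_mul, Matrix.mul_one, transpose_matV_mul_matV T₀ hv,
      mul_vecMulVec, vecMulVec_mul]
  rw [matR, transpose_matV_mul_covM, Matrix.mul_assoc, Matrix.mul_assoc, ← Matrix.mul_assoc _ᵀ,
    hcompress, mulVec_sub, transpose_matV_mulVec_one T₀ hv, mulVec_single_one,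
    single_one_vecMul]
  congr 2
  ext i j
  have hn : (0 : ℝ) < v.choose t := by exact_mod_cast Nat.choose_pos (by omega)
  have hsq := Real.sq_sqrt hn.le
  simp only [vecMulVec_apply, Pi.sub_apply, col_apply, transpose_apply, row_apply,
    matV_apply_self T₀ hv, Pi.single_apply, Real.sqrt_div (Nat.cast_nonneg _)]
  split_ifs <;> field_simp <;> linear_combination √(mult v i) * √(mult v j) * hsq

lemma charpoly_matR (hv : 2 * t ≤ v) :
    (matR k T₀).charpoly = secularPoly (fun j : Fin (t + 1) => theta v t k j)
      fun j => theta v t k j * ((if j = 0 then 1 else 0) - (mult v j : ℝ) / v.choose t) := by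
  rw [matR_eq T₀ hv, Matrix.mul_add, Matrix.mul_one, mul_vecMulVec, matTheta,
    charpoly_diagonal_add_vecMulVec]
  congr 1
  ext j
  rw [Pi.mul_apply, mulVec_diagonal, mul_left_comm, mul_sub, ← mul_div_assoc,
    Real.mul_self_sqrt (Nat.cast_nonneg _)]
  split_ifs with h <;> simp [h, mult]

lemma charpoly_covM₁ (hv : 2 * t ≤ v) :
    (covM₁ k T₀).charpoly
      = (matR k T₀).charpoly * ∏ j ∈ Finset.Icc 1 t, (X - C (theta v t k j)) ^ (mult v j - 1) := by
  let c : EuclideanSpace ℝ (TSet v t) := WithLp.toLp 2 1 - EuclideanSpace.single T₀ 1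
  let a (j : Fin (t + 1)) : TSet v t → ℝ :=
    theta v t k j • ((johnsonSpace v t j).starProjection c).ofLp
  have hperturb : covM₁ k T₀ = covM v t k + vecMulVec (∑ j, a j) (Pi.single T₀ 1) := by
    rw [covM₁, matB_eq, Matrix.mul_add, Matrix.mul_one, mul_vecMulVec,
      ← covM_mulVec_eq_sum hv k c]
    rfl
  have heigen : ∀ j, covM v t k *ᵥ a j = theta v t k j • a j := fun j => by
    rw [mulVec_smul, covM_mulVec_of_mem_johnsonSpace (Submodule.starProjection_apply_mem _ _)]
  have happly : ∀ j, Pi.single T₀ 1 ⬝ᵥ a j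
      = theta v t k j * ((if j = 0 then 1 else 0) - (mult v j : ℝ) / v.choose t) := by
    intro j
    rw [single_one_dotProduct]
    change theta v t k j * (johnsonSpace v t j).starProjection c T₀ = _
    rw [map_sub,
      starProjection_johnsonSpace_one hv, PiLp.sub_apply,
      starProjection_johnsonSpace_single_apply hv]
    split_ifs <;> rfl
  have hprod : ∏ j : Fin (t + 1), (X - C (theta v t k j)) ^ (mult v j - 1)
      = ∏ j ∈ Finset.Icc 1 t, (X - C (theta v t k j)) ^ (mult v j - 1) := by
    rw [← Finset.prod_range fun j => (X - C (theta v t k j)) ^ (mult v j - 1),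
      Finset.prod_range_eq_mul_Ico _ t.succ_pos]
    exact one_mul _
  rw [hperturb, charpoly_add_vecMulVec_eq_secularPoly_mul heigen (fun j => mult_pos (by omega))
    (charpoly_covM k hv), funext happly, ← charpoly_matR T₀ hv, hprod]

lemma rank_matR_sub_matTheta (ht : 1 ≤ t) (hk : 2 * t ≤ k) (hv : k ≤ v) :
    (matR k T₀ - matTheta v t k).rank = 1 := by
  have hn : 1 < v.choose t := by
    have hpos : 0 < v.choose t := Nat.choose_pos (by omega)
    have hne : v.choose t ≠ 1 := Nat.choose_eq_one_iff.not.2 (by omega)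
    omega
  have hu : (1 : ℝ) - 1 / v.choose t ≠ 0 :=
    (sub_pos.2 ((div_lt_one (by positivity)).2 (Nat.one_lt_cast.2 hn))).ne'
  rw [matR_eq T₀ (hk.trans hv), Matrix.mul_add, Matrix.mul_one, mul_vecMulVec, add_sub_cancel_left]
  refine rank_vecMulVec_eq_one (Function.ne_iff.2 ⟨0, ?_⟩) (Function.ne_iff.2 ⟨0, ?_⟩)
  · rw [matTheta, mulVec_diagonal]
    simpa [mult] using ⟨(theta_pos hk hv t.zero_le).ne', by simpa using hu⟩
  · simp [mult]

end Compression

section Spectrum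

variable {v t k : ℕ}

lemma theta_strictAnti (hk : 2 * t ≤ k) (hv : k + t ≤ v) :
    StrictAnti fun j : Fin (t + 1) => theta v t k j := by
  refine Fin.strictAnti_iff_succ_lt.2 fun i => ?_
  have hi := i.is_lt
  have hleft : (k - (i + 1)).choose (t - (i + 1)) < (k - i).choose (t - i) := by
    rw [show k - i = k - (i + 1) + 1 by omega, show t - i = t - (i + 1) + 1 by omega,
      Nat.choose_succ_succ']
    exact Nat.lt_add_of_pos_right (Nat.choose_pos (by omega))
  have hright : (v - t - (i + 1)).choose (k - t) ≤ (v - t - i).choose (k - t) :=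
    Nat.choose_le_choose _ (by omega)
  have hpos : 0 < (v - t - i).choose (k - t) := Nat.choose_pos (by omega)
  simp only [Fin.val_succ, Fin.val_castSucc]
  rw [theta_eq hk (by omega) hi, theta_eq hk (by omega) hi.le]
  exact_mod_cast Nat.mul_lt_mul_of_lt_of_le hleft hright hpos

lemma theta_zero_le (hk : 2 * t ≤ k) (hv : k ≤ v) :
    theta v t k 0 ≤ k.choose t * (v : ℝ) ^ (k - t) := by
  have hle : (v - t).choose (k - t) ≤ v ^ (k - t) :=
    (Nat.choose_le_pow _ _).trans (Nat.pow_le_pow_left (by omega) _)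
  rw [theta_eq hk hv t.zero_le]
  exact_mod_cast Nat.mul_le_mul_left _ hle

lemma le_theta_self (hk : 2 * t ≤ k) (hv : 2 * (k + t) ≤ v) :
    (2 ^ (k - t) * (k - t).factorial : ℝ)⁻¹ * (v : ℝ) ^ (k - t) ≤ theta v t k t := by
  have hhalf : (v : ℝ) ≤ 2 * ((v - t - t + 1 - (k - t) : ℕ) : ℝ) := by
    exact_mod_cast (by omega : v ≤ 2 * (v - t - t + 1 - (k - t)))
  rw [theta_eq hk (by omega) le_rfl, Nat.sub_self, Nat.choose_zero_right, Nat.cast_one, one_mul,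
    inv_mul_eq_div, ← div_div, ← div_pow]
  refine le_trans ?_ (Nat.pow_le_choose (k - t) (v - t - t))
  gcongr
  linarith

lemma exists_roots_matR (hk : 2 * t ≤ k) (hv : k + t ≤ v) (T₀ : TSet v t) :
    ∃ ρ : Fin (t + 1) → ℝ, StrictMono ρ ∧ (matR k T₀).charpoly = ∏ i, (X - C (ρ i)) ∧
      ∀ i, ρ i ∈ Set.Ioo (theta v t k t / 2) (2 * theta v t k 0) := by
  have hn : (0 : ℝ) < v.choose t := by exact_mod_cast Nat.choose_pos (by omega)
  rw [charpoly_matR T₀ (by omega)]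
  refine exists_roots_secularPoly_of_weights (theta_strictAnti hk hv)
    (fun j => theta_pos hk (by omega) j.is_le)
    (fun j => div_pos (Nat.cast_pos.2 (mult_pos (by omega))) hn) ?_
  rw [← Finset.sum_div, div_eq_one_iff_eq hn.ne']
  exact_mod_cast sum_mult (by omega)

lemma exists_eq_ofReal_of_hasEigenvalue_covM₁ (hk : 2 * t ≤ k) (hv : k + t ≤ v) (T₀ : TSet v t)
    {z : ℂ} (hz : Module.End.HasEigenvalue
      (Matrix.toLin' ((covM₁ k T₀).map (algebraMap ℝ ℂ))) z) :
    ∃ x ∈ Set.Ioo (theta v t k t / 2) (2 * theta v t k 0), z = (x : ℂ) := by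
  obtain ⟨ρ, -, hρ, hmem⟩ := exists_roots_matR hk hv T₀
  rw [Module.End.hasEigenvalue_iff_isRoot_charpoly, Matrix.charpoly_toLin', Matrix.charpoly_map,
    charpoly_covM₁ T₀ (by omega), hρ, IsRoot.def, eval_map_algebraMap, map_mul, map_prod, map_prod,
    mul_eq_zero, Finset.prod_eq_zero_iff, Finset.prod_eq_zero_iff] at hz
  simp only [map_pow, map_sub, aeval_X, aeval_C, Complex.coe_algebraMap] at hz
  rcases hz with ⟨i, -, hi⟩ | ⟨j, hj, hroot⟩
  · exact ⟨ρ i, hmem i, sub_eq_zero.1 hi⟩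
  · have hjt := (Finset.mem_Icc.1 hj).2
    have hanti := (theta_strictAnti hk hv).antitone
    have hle := hanti (Fin.zero_le (⟨j, Nat.lt_succ_of_le hjt⟩ : Fin (t + 1)))
    have hge := hanti (Fin.le_last (⟨j, Nat.lt_succ_of_le hjt⟩ : Fin (t + 1)))
    have hlast := theta_pos hk hv le_rfl
    simp only [Fin.val_last, Fin.val_zero] at hle hge
    exact ⟨theta v t k j, ⟨by linarith, by linarith⟩, sub_eq_zero.1 (eq_zero_of_pow_eq_zero hroot)⟩

end Spectrum

end JohnsonCoverage

open JohnsonCoverage in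
theorem proposition5p1 (t k : ℕ) (ht : 1 ≤ t) (hk : 2 * t ≤ k) :
    -- structure of `R` and factorization of the characteristic polynomial of `M₁`
    (∀ v : ℕ, k ≤ v → ∀ T₀ : TSet v t,
      (covM₁ k T₀).charpoly
          = (matR k T₀).charpoly
            * ∏ j ∈ Finset.Icc 1 t, (X - C (theta v t k j)) ^ (mult v j - 1) ∧
      matR k T₀
          = matTheta v t k * (1 + Matrix.vecMulVec
              (fun i : Fin (t + 1) =>
                (if i = 0 then 1 else 0) - √(mult v i : ℝ) / (v.choose t : ℝ))
              (fun j : Fin (t + 1) => √(mult v j : ℝ))) ∧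
      (matR k T₀ - matTheta v t k).rank = 1) ∧
    -- location and order of the eigenvalues, for all large `v`
    (∃ (v₀ : ℕ) (c c' : ℝ), 0 < c ∧ 0 < c' ∧
      ∀ v : ℕ, v₀ ≤ v → k ≤ v → ∀ T₀ : TSet v t,
        (∃ ρ : Fin (t + 1) → ℝ, StrictMono ρ ∧
          (matR k T₀).charpoly = ∏ i, (X - C (ρ i)) ∧
          ∀ i, theta v t k t / 2 < ρ i) ∧
        (∀ z : ℂ,
          Module.End.HasEigenvalue
              (Matrix.toLin' ((covM₁ k T₀).map (algebraMap ℝ ℂ))) z →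
          ∃ x : ℝ, z = (x : ℂ) ∧ theta v t k t / 2 < x ∧
            c * (v : ℝ) ^ (k - t) ≤ x ∧ x ≤ c' * (v : ℝ) ^ (k - t))) := by
  refine ⟨fun v hv T₀ => ⟨charpoly_covM₁ T₀ (hk.trans hv), matR_eq T₀ (hk.trans hv),
    rank_matR_sub_matTheta T₀ ht hk hv⟩, 2 * (k + t),
    (2 ^ (k - t) * (k - t).factorial : ℝ)⁻¹ / 2, 2 * k.choose t, by positivity,
    mul_pos two_pos (Nat.cast_pos.2 (Nat.choose_pos (by omega))),
    fun v hv₀ hv T₀ => ⟨?_, fun z hz => ?_⟩⟩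
  · obtain ⟨ρ, hmono, hchar, hmem⟩ := exists_roots_matR hk (by omega) T₀
    exact ⟨ρ, hmono, hchar, fun i => (hmem i).1⟩
  · obtain ⟨x, ⟨hlow, hupp⟩, rfl⟩ := exists_eq_ofReal_of_hasEigenvalue_covM₁ hk (by omega) T₀ hz
    have hzero := theta_zero_le hk hv
    have hlast := le_theta_self hk hv₀
    exact ⟨x, rfl, hlow, by linarith, by linarith⟩
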